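/- Let $\mathcal{C}$ be a pointed model category with functorial factorizations (a model category whose initial and terminal objects coincide; write $*$ for this zero object). Let $[X,Y]$ denote the set of morphisms from $X$ to $Y$ in the homotopy category of $\mathcal{C}$, the localization at the weak equivalences; its elements are called weak homotopy classes, and the trivial class is the class of the zero map $X\to *\to Y$. The fibre of a map $p\colon X\to Y$ is the pullback of $p$ along $*\to Y$. An object $B$ is weakly contractible if $B\to *$ is a weak equivalence. $\mathcal{C}$ is left proper if every cobase change of a weak equivalence along a cofibration is a weak equivalence. A cofibration $i\colon A\to B$ has a fibrant obstruction theory if there exist an object $W$ and, for every fibration $p\colon X\to Y$ with $Y$ fibrant and fibre $F$ and every commutative square $$\begin{array}{ccc} A & \longrightarrow & X \\ {\scriptstyle i}\downarrow & & \downarrow{\scriptstyle p} \\ B & \longrightarrow & Y \end{array}$$ (regarded as a map $i\to p$ in the category of arrows of $\mathcal{C}$), a weak homotopy class $\alpha\in[W,F]$, the obstruction of the square, such that 1. there is a map $B\to X$ making both triangles in the square commute if and only if $\alpha$ is the trivial class; and 2. for every map $p\to p'$ (a commutative square) between fibrations with fibrant targets and with fibres $F$ and $F'$, and every map $i\to p$,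 the obstruction of the composite $i\to p\to p'$ is the composite of the obstruction of $i\to p$ with the class of the induced map $F\to F'$. **Corollary 6.4.** Let $i\colon A\to B$ be a cofibration in $\mathcal{C}$ such that $B$ is weakly contractible. Suppose also that $A$ is cofibrant or that $\mathcal{C}$ is left proper. Then $i$ has a fibrant obstruction theory. -/

import Mathlib

universe v u

open CategoryTheory Limits HomotopicalAlgebra

namespace HomotopicalAlgebra

/-- A model category is left proper if every cobase change of a weak equivalence `w`
along a cofibration `i` is a weak equivalence. -/
class IsLeftProper (C : Type u) [Category.{v} C] [ModelCategory C] : Prop where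
  weakEquivalence_of_isPushout {A A' B B' : C} {w : A ⟶ A'} {i : A ⟶ B} {i' : A' ⟶ B'}
    {w' : B ⟶ B'} (sq : IsPushout w i i' w') (hw : WeakEquivalence w) (hi : Cofibration i) :
    WeakEquivalence w'

variable {C : Type u} [Category.{v} C] [ModelCategory C]

/-- An object is weakly contractible if its map to the terminal object
(the zero object, when `C` is pointed) is a weak equivalence. -/
def IsWeaklyContractible (X : C) : Prop := WeakEquivalence (terminal.from X)

/-- The set `[X, Y]` of weak homotopy classes of maps from `X` to `Y`: the morphisms from `X`
to `Y` in the homotopy category of `C`, the localization of `C` at the weak equivalences. -/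
abbrev WeakHomotopyClass (X Y : C) :=
  (weakEquivalences C).Q.obj X ⟶ (weakEquivalences C).Q.obj Y

/-- The weak homotopy class of a map. -/
abbrev WeakHomotopyClass.of {X Y : C} (f : X ⟶ Y) : WeakHomotopyClass X Y :=
  (weakEquivalences C).Q.map f

section Pointed

variable [HasZeroMorphisms C]

/-- The fibre of a map `p : X ⟶ Y`, an object of the category of arrows, in a pointed model
category: the pullback of `p` along the map `* ⟶ Y`, that is, the kernel of `p`. -/
noncomputable abbrev fibre (p : Arrow C) : C := kernel p.hom

/-- The map induced on fibres by a map of arrows, that is, by a commutative square. -/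
noncomputable abbrev fibreMap {p p' : Arrow C} (g : p ⟶ p') : fibre p ⟶ fibre p' :=
  kernel.map p.hom p'.hom g.left g.right (Arrow.w g).symm

/-- A fibrant obstruction theory for `i` consists of an object `W` and, for every map of arrows
`f : i ⟶ p` (a commutative square) to a fibration `p` with fibrant target, of a weak homotopy
class from `W` to the fibre of `p`, the obstruction of `f`. A lift exists in the square if and only
if the obstruction is the trivial class, and the obstructions are functorial in `p`. -/
structure FibrantObstructionTheory {A B : C} (i : A ⟶ B) where
  /-- the source of the obstruction classes -/
  W : C
  /-- the obstruction of a square from `i` to `p` -/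
  obstruction (p : Arrow C) (hp : Fibration p.hom) (hY : IsFibrant p.right)
    (f : Arrow.mk i ⟶ p) : WeakHomotopyClass W (fibre p)
  exists_lift_iff (p : Arrow C) (hp : Fibration p.hom) (hY : IsFibrant p.right)
    (f : Arrow.mk i ⟶ p) :
    (∃ l : B ⟶ p.left, i ≫ l = f.left ∧ l ≫ p.hom = f.right) ↔
      obstruction p hp hY f = WeakHomotopyClass.of 0
  obstruction_comp (p p' : Arrow C) (hp : Fibration p.hom) (hY : IsFibrant p.right)
    (hp' : Fibration p'.hom) (hY' : IsFibrant p'.right) (f : Arrow.mk i ⟶ p) (g : p ⟶ p') :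
    obstruction p' hp' hY' (f ≫ g) =
      obstruction p hp hY f ≫ WeakHomotopyClass.of (fibreMap g)

/-- The property that `i` has a fibrant obstruction theory. -/
def HasFibrantObstructionTheory {A B : C} (i : A ⟶ B) : Prop :=
  Nonempty (FibrantObstructionTheory i)

end Pointed

end HomotopicalAlgebra

namespace HomotopicalAlgebra

attribute [local simp] prod.lift_fst prod.lift_snd prod.lift_fst_assoc prod.lift_snd_assoc
  pullback.lift_fst pullback.lift_snd pullback.lift_fst_assoc pullback.lift_snd_assoc
  pushout.inl_desc pushout.inr_desc pushout.inl_desc_assoc pushout.inr_desc_assoc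

section

variable {C : Type u} [Category.{v} C] [ModelCategory C]

/-! Factor `B ⟶ Y` as a trivial cofibration `B ⟶ E` and a fibration `E ⟶ Y`, and pull `p` back to a
fibration `P ⟶ E` with the same fibre `F`. As `E` is fibrant and weakly contractible, `F ⟶ P` is a
weak equivalence (`weakEquivalence_kernel_ι`), so the induced map `A ⟶ P` defines a class in `[A,
F]`: the obstruction, with `W = A`. Functoriality of the factorization makes it natural in `p`.

A lift makes `A ⟶ P` factor through `B`, hence trivial. Conversely, if `A` is cofibrant, triviality
gives a homotopy from zero, which is extended over `B` and corrected to a lift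
(`exists_lift_of_map_eq`). Left properness reduces the general case to this one by cofibrant
replacement (`exists_lift_of_isLeftProper`). -/

lemma IsWeaklyContractible.of_weakEquivalence {X Y : C} (hX : IsWeaklyContractible X)
    (f : X ⟶ Y) [WeakEquivalence f] : IsWeaklyContractible Y := by
  have : WeakEquivalence (terminal.from X) := hX
  exact weakEquivalence_of_precomp_of_fac (f := f) (Subsingleton.elim _ (terminal.from X))

lemma weakEquivalence_prod_fst {X Y : C} [IsFibrant Y] (hY : IsWeaklyContractible Y) :
    WeakEquivalence (prod.fst : X ⨯ Y ⟶ X) := by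
  have : WeakEquivalence (terminal.from Y) := hY
  rw [weakEquivalence_iff]
  exact (MorphismProperty.of_isPullback
    (IsPullback.of_isLimit_binaryFan_of_isTerminal
      (limit.isLimit (pair X Y)) terminalIsTerminal).flip
    (mem_trivialFibrations (terminal.from Y))).2

/-- If `r : P ⟶ E` is a fibration between fibrant objects with `E` weakly contractible and `Q` is
a good path object of `P`, then a path in `P` can be prescribed, up to lifting against cofibrations,
by its source and by the image in `E` of its target. -/
lemma PathObject.mem_trivialFibrations_lift {P E : C} (r : P ⟶ E) [Fibration r] [IsFibrant E]
    (hE : IsWeaklyContractible E) (Q : PathObject P) [Q.IsGood] :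
    trivialFibrations C (prod.lift Q.p₀ (Q.p₁ ≫ r)) := by
  have : IsFibrant P := isFibrant_of_fibration r
  have h₁ : prod.lift Q.p₀ (Q.p₁ ≫ r) = Q.p ≫ prod.map (𝟙 P) r := by
    ext <;> simp
  have h₂ : prod.lift Q.p₀ (Q.p₁ ≫ r) ≫ prod.fst = Q.p₀ := by simp
  have := weakEquivalence_prod_fst (X := P) hE
  rw [mem_trivialFibrations_iff]
  exact ⟨h₁ ▸ inferInstance, weakEquivalence_of_postcomp_of_fac h₂⟩

/-- A square from a cofibration `i` with cofibrant source to a fibration with weakly contractible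
fibrant base admits a lift if its upper edge is equal to `i ≫ g` in the homotopy category, for
some `g`. -/
lemma exists_lift_of_map_eq {A B P E : C} (i : A ⟶ B) [Cofibration i] [IsCofibrant A]
    (r : P ⟶ E) [Fibration r] [IsFibrant E] (hE : IsWeaklyContractible E)
    (f : A ⟶ P) (b : B ⟶ E) (fac : f ≫ r = i ≫ b) (g : B ⟶ P)
    (hfg : WeakHomotopyClass.of f = WeakHomotopyClass.of (i ≫ g)) :
    ∃ l : B ⟶ P, i ≫ l = f ∧ l ≫ r = b := by
  have : IsFibrant P := isFibrant_of_fibration r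
  -- `A` is cofibrant and `P` is fibrant, so equality of classes is right homotopy.
  obtain ⟨Q, _, ⟨h⟩⟩ := ((RightHomotopyRel.iff_map_eq (weakEquivalences C).Q _ _).2 hfg.symm).exists_good_pathObject
  obtain ⟨g', -, hg'⟩ : ∃ (g' : B ⟶ P) (_ : Q.RightHomotopy g g'), i ≫ g' = f := by
    obtain ⟨g', h', e⟩ := PathObject.RightHomotopy.homotopy_extension h i g
    exact ⟨g', h', by rw [← h'.h₁, reassoc_of% e, h.h₁]⟩
  obtain ⟨_, _⟩ := (mem_trivialFibrations_iff _).1 (Q.mem_trivialFibrations_lift r hE)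
  -- `g'` extends `f` but need not lie over `b`: lift to a path from `g'` to a map over `b`,
  -- constant on `A`.
  have sq : CommSq (f ≫ Q.ι) i (prod.lift Q.p₀ (Q.p₁ ≫ r)) (prod.lift g' b) :=
    ⟨by ext <;> simp [hg', fac]⟩
  refine ⟨sq.lift ≫ Q.p₁, by simp, ?_⟩
  have := sq.fac_right =≫ prod.snd
  simpa using this

/-- A lift over one object under `A` and over `Y` can be transferred along a weak equivalence
between cofibrations with source `A`. -/
lemma exists_lift_of_weakEquivalence {A U V X Y : C} (u : A ⟶ U) (v : A ⟶ V) [Cofibration v]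
    (w : U ⟶ V) [WeakEquivalence w] (fac : u ≫ w = v) (p : X ⟶ Y) [Fibration p] (b : V ⟶ Y)
    (l : U ⟶ X) (hl : l ≫ p = w ≫ b) :
    ∃ l' : V ⟶ X, v ≫ l' = u ≫ l ∧ l' ≫ p = b := by
  -- The trivial cofibration extends `l`; the remaining fibration is trivial, so `v` lifts against
  -- it.
  let h := MorphismProperty.factorizationData (trivialCofibrations C) (fibrations C) w
  have : WeakEquivalence h.p := weakEquivalence_of_precomp_of_fac h.fac
  have sq : CommSq (u ≫ h.i) v h.p (𝟙 V) := ⟨by simp [fac]⟩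
  have sq' : CommSq l h.i p (h.p ≫ b) := ⟨by simp [hl]⟩
  refine ⟨sq.lift ≫ sq'.lift, by simp, ?_⟩
  rw [Category.assoc, sq'.fac_right, sq.fac_right_assoc, Category.id_comp]

/-- In a left proper model category, a cofibration lifts against a fibration in a given square as
soon as a cofibration weakly equivalent to it does. -/
lemma exists_lift_of_isLeftProper [IsLeftProper C] {A B A' B' X Y : C} (i : A ⟶ B) [Cofibration i]
    (i' : A' ⟶ B') [Cofibration i'] (s : A' ⟶ A) [WeakEquivalence s] (t : B' ⟶ B)
    [WeakEquivalence t] (fac : i' ≫ t = s ≫ i) (p : X ⟶ Y) [Fibration p] (a : A ⟶ X) (b : B ⟶ Y)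
    (w : a ≫ p = i ≫ b) (l : B' ⟶ X) (hl : i' ≫ l = s ≫ a) (hl' : l ≫ p = t ≫ b) :
    ∃ l' : B ⟶ X, i ≫ l' = a ∧ l' ≫ p = b := by
  have : WeakEquivalence (pushout.inr s i') :=
    IsLeftProper.weakEquivalence_of_isPushout (IsPushout.of_hasPushout s i')
      inferInstance inferInstance
  have h : pushout.inr s i' ≫ pushout.desc i t fac.symm = t := by simp
  have : WeakEquivalence (pushout.desc i t fac.symm) := weakEquivalence_of_precomp_of_fac h
  obtain ⟨l', h₁, h₂⟩ := exists_lift_of_weakEquivalence (pushout.inl s i') i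
    (pushout.desc i t fac.symm) (by simp) p b (pushout.desc a l hl.symm)
    (by ext <;> simp [w, hl'])
  exact ⟨l', by simpa using h₁, h₂⟩

lemma WeakHomotopyClass.of_comp {X Y Z : C} (f : X ⟶ Y) (g : Y ⟶ Z) :
    WeakHomotopyClass.of (f ≫ g) = WeakHomotopyClass.of f ≫ WeakHomotopyClass.of g :=
  Functor.map_comp _ _ _

/-! ### Trivial classes and fibre inclusions -/

variable [HasZeroMorphisms C]

/-- The identity and the zero map of `B` agree after the map to the terminal object, which becomes
invertible. -/
lemma IsWeaklyContractible.of_eq_zero {B Z : C} (hB : IsWeaklyContractible B) (f : B ⟶ Z) :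
    WeakHomotopyClass.of f = WeakHomotopyClass.of 0 := by
  have : WeakEquivalence (terminal.from B) := hB
  have : IsIso ((weakEquivalences C).Q.map (terminal.from B)) :=
    Localization.inverts _ (weakEquivalences C) _ (mem_weakEquivalences _)
  have h : WeakHomotopyClass.of (0 : B ⟶ B) = 𝟙 _ := by
    rw [← cancel_mono ((weakEquivalences C).Q.map (terminal.from B)), Category.id_comp,
      ← Functor.map_comp]
    congr 1
    exact Subsingleton.elim _ _
  calc
    WeakHomotopyClass.of f = WeakHomotopyClass.of (0 : B ⟶ B) ≫ WeakHomotopyClass.of f := by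
      rw [h, Category.id_comp]
    _ = WeakHomotopyClass.of 0 := by rw [← Functor.map_comp, zero_comp]

/-- The fibre inclusion of a fibration over a weakly contractible fibrant object is a weak
equivalence. -/
lemma weakEquivalence_kernel_ι {P E : C} (r : P ⟶ E) [Fibration r] [IsFibrant E]
    (hE : IsWeaklyContractible E) : WeakEquivalence (kernel.ι r) := by
  have : IsFibrant P := isFibrant_of_fibration r
  obtain ⟨Q, _⟩ := PathObject.exists_very_good P
  -- The pullback consists of paths in `P` ending in the fibre of `r`.
  let m := pullback.fst Q.p₁ (kernel.ι r)
  have sq : IsPullback m (m ≫ Q.p₀) (prod.lift Q.p₀ (Q.p₁ ≫ r)) (prod.lift (𝟙 P) 0) := by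
    refine ⟨⟨?_⟩, ⟨PullbackCone.IsLimit.mk _
      (fun s ↦ pullback.lift s.fst (kernel.lift r (s.fst ≫ Q.p₁) ?_) ?_) ?_ ?_ ?_⟩⟩
    · ext <;> simp [m, pullback.condition_assoc]
    · simpa using s.condition =≫ prod.snd
    · simp
    · intro s
      simp [m]
    · intro s
      simpa [m] using s.condition =≫ prod.fst
    · intro s l h₁ h₂
      ext
      · simpa [m] using h₁
      · simp [← h₁, m, pullback.condition]
  have h₀ : WeakEquivalence (m ≫ Q.p₀) := by
    rw [weakEquivalence_iff]
    exact (MorphismProperty.of_isPullback sq (Q.mem_trivialFibrations_lift r hE)).2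
  -- Constant paths: a section of a base change of the trivial fibration `Q.p₁`.
  let c : kernel r ⟶ pullback Q.p₁ (kernel.ι r) := pullback.lift (kernel.ι r ≫ Q.ι) (𝟙 _) (by simp)
  have hc : c ≫ pullback.snd _ _ = 𝟙 _ := by simp [c]
  have : WeakEquivalence c := weakEquivalence_of_postcomp_of_fac hc
  have hι : kernel.ι r = c ≫ m ≫ Q.p₀ := by simp [c, m]
  rw [hι]
  infer_instance

end

namespace FibrantObstructionTheory

/-! ### The auxiliary fibration and its functoriality -/

variable {C : Type u} [Category.{v} C] [ModelCategory C]
  (D : MorphismProperty.FunctorialFactorizationData (trivialCofibrations C) (fibrations C))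
  {A B : C} {i : A ⟶ B} {p p' : Arrow C}

/-- The base of the auxiliary fibration: the middle object of the factorization of `B ⟶ Y`. -/
abbrev base (f : Arrow.mk i ⟶ p) : C := (D.factorizationData f.right).Z

/-- The total object of the auxiliary fibration: the pullback of `X ⟶ Y` to `base D f`. -/
noncomputable abbrev total (f : Arrow.mk i ⟶ p) : C :=
  pullback p.hom (D.factorizationData f.right).p

/-- The auxiliary fibration, a pullback of `p`. -/
noncomputable abbrev proj (f : Arrow.mk i ⟶ p) : total D f ⟶ base D f :=
  pullback.snd p.hom (D.factorizationData f.right).p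

/-- The map from `A` to the total object of the auxiliary fibration. -/
noncomputable def toTotal (f : Arrow.mk i ⟶ p) : A ⟶ total D f :=
  pullback.lift f.left (i ≫ (D.factorizationData f.right).i) (by simp)

lemma isWeaklyContractible_base (hB : IsWeaklyContractible B) (f : Arrow.mk i ⟶ p) :
    IsWeaklyContractible (base D f) :=
  hB.of_weakEquivalence (D.factorizationData f.right).i

lemma isFibrant_base (hY : IsFibrant p.right) (f : Arrow.mk i ⟶ p) : IsFibrant (base D f) :=
  isFibrant_of_fibration (D.factorizationData f.right).p

/-- The map induced on bases of auxiliary fibrations. -/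
noncomputable def baseMap (f : Arrow.mk i ⟶ p) (g : p ⟶ p') : base D f ⟶ base D (f ≫ g) :=
  D.mapZ (Arrow.homMk (f := Arrow.mk f.right) (g := Arrow.mk (f ≫ g).right) (𝟙 B) g.right (by simp))

lemma i_baseMap (f : Arrow.mk i ⟶ p) (g : p ⟶ p') :
    (D.factorizationData f.right).i ≫ baseMap D f g = (D.factorizationData (f ≫ g).right).i :=
  (D.i_mapZ _).trans (Category.id_comp _)

lemma baseMap_p (f : Arrow.mk i ⟶ p) (g : p ⟶ p') :
    baseMap D f g ≫ (D.factorizationData (f ≫ g).right).p =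
      (D.factorizationData f.right).p ≫ g.right :=
  D.mapZ_p _

/-- The map induced on total objects of auxiliary fibrations. -/
noncomputable def totalMap (f : Arrow.mk i ⟶ p) (g : p ⟶ p') : total D f ⟶ total D (f ≫ g) :=
  pullback.map _ _ _ _ g.left (baseMap D f g) g.right (Arrow.w g).symm (baseMap_p D f g).symm

lemma totalMap_fst (f : Arrow.mk i ⟶ p) (g : p ⟶ p') :
    totalMap D f g ≫ pullback.fst _ _ = pullback.fst _ _ ≫ g.left :=
  pullback.lift_fst _ _ _

lemma totalMap_proj (f : Arrow.mk i ⟶ p) (g : p ⟶ p') :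
    totalMap D f g ≫ proj D (f ≫ g) = proj D f ≫ baseMap D f g :=
  pullback.lift_snd _ _ _

lemma toTotal_fst (f : Arrow.mk i ⟶ p) : toTotal D f ≫ pullback.fst _ _ = f.left :=
  pullback.lift_fst _ _ _

lemma toTotal_proj (f : Arrow.mk i ⟶ p) :
    toTotal D f ≫ proj D f = i ≫ (D.factorizationData f.right).i :=
  pullback.lift_snd _ _ _

lemma toTotal_comp (f : Arrow.mk i ⟶ p) (g : p ⟶ p') :
    toTotal D (f ≫ g) = toTotal D f ≫ totalMap D f g := by
  apply pullback.hom_ext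
  · rw [toTotal_fst, Category.assoc, totalMap_fst, ← Category.assoc, toTotal_fst]
    rfl
  · rw [toTotal_proj, Category.assoc, totalMap_proj, ← Category.assoc, toTotal_proj,
      Category.assoc, i_baseMap]

/-! ### The obstruction class -/

variable [HasZeroMorphisms C]

/-- The comparison of the fibre of the auxiliary fibration with the fibre of `p`. -/
noncomputable def fibreComparison (f : Arrow.mk i ⟶ p) : kernel (proj D f) ⟶ fibre p :=
  kernel.map _ _ (pullback.fst _ _) (D.factorizationData f.right).p pullback.condition.symm

instance (f : Arrow.mk i ⟶ p) : IsIso (fibreComparison D f) :=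
  isIso_kernel_map_of_isPullback (IsPullback.of_hasPullback p.hom _).flip

lemma isIso_of_kernel_ι_proj (hB : IsWeaklyContractible B) (hp : Fibration p.hom)
    (hY : IsFibrant p.right) (f : Arrow.mk i ⟶ p) :
    IsIso (WeakHomotopyClass.of (kernel.ι (proj D f))) := by
  have := isFibrant_base D hY f
  have := weakEquivalence_kernel_ι (proj D f) (isWeaklyContractible_base D hB f)
  exact Localization.inverts _ (weakEquivalences C) _ (mem_weakEquivalences _)

/-- The obstruction class of a square. -/
noncomputable def cls (hB : IsWeaklyContractible B) (hp : Fibration p.hom)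
    (hY : IsFibrant p.right) (f : Arrow.mk i ⟶ p) : WeakHomotopyClass A (fibre p) :=
  have := isIso_of_kernel_ι_proj D hB hp hY f
  WeakHomotopyClass.of (toTotal D f) ≫ inv (WeakHomotopyClass.of (kernel.ι (proj D f))) ≫
    WeakHomotopyClass.of (fibreComparison D f)

lemma cls_eq_zero_iff (hB : IsWeaklyContractible B) (hp : Fibration p.hom)
    (hY : IsFibrant p.right) (f : Arrow.mk i ⟶ p) :
    cls D hB hp hY f = WeakHomotopyClass.of 0 ↔
      WeakHomotopyClass.of (toTotal D f) = WeakHomotopyClass.of 0 := by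
  have := isIso_of_kernel_ι_proj D hB hp hY f
  have h₀ : WeakHomotopyClass.of (0 : A ⟶ fibre p) =
      WeakHomotopyClass.of (0 : A ⟶ total D f) ≫
        inv (WeakHomotopyClass.of (kernel.ι (proj D f))) ≫
          WeakHomotopyClass.of (fibreComparison D f) := by
    have e : WeakHomotopyClass.of (0 : A ⟶ total D f) =
        WeakHomotopyClass.of (0 : A ⟶ kernel (proj D f)) ≫
          WeakHomotopyClass.of (kernel.ι (proj D f)) := by
      rw [← Functor.map_comp, zero_comp]
    rw [e, Category.assoc, IsIso.hom_inv_id_assoc, ← Functor.map_comp, zero_comp]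
  rw [h₀, cls, cancel_mono]

lemma cls_comp (hB : IsWeaklyContractible B) (hp : Fibration p.hom) (hY : IsFibrant p.right)
    (hp' : Fibration p'.hom) (hY' : IsFibrant p'.right) (f : Arrow.mk i ⟶ p) (g : p ⟶ p') :
    cls D hB hp' hY' (f ≫ g) = cls D hB hp hY f ≫ WeakHomotopyClass.of (fibreMap g) := by
  have := isIso_of_kernel_ι_proj D hB hp hY f
  have := isIso_of_kernel_ι_proj D hB hp' hY' (f ≫ g)
  let k : kernel (proj D f) ⟶ kernel (proj D (f ≫ g)) :=
    kernel.map _ _ (totalMap D f g) (baseMap D f g) (totalMap_proj D f g).symm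
  have h₂ : k ≫ kernel.ι (proj D (f ≫ g)) = kernel.ι (proj D f) ≫ totalMap D f g :=
    kernel.lift_ι _ _ _
  have h₃ : k ≫ fibreComparison D (f ≫ g) = fibreComparison D f ≫ fibreMap g := by
    rw [← cancel_mono (kernel.ι p'.hom), Category.assoc, Category.assoc, fibreComparison,
      fibreComparison, kernel.lift_ι, kernel.lift_ι, reassoc_of% h₂, totalMap_fst,
      kernel.lift_ι_assoc, Category.assoc]
  -- Naturality of the fibre inclusions, `h₂`, passed to their inverses.
  have h₄ : WeakHomotopyClass.of (totalMap D f g) ≫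
      inv (WeakHomotopyClass.of (kernel.ι (proj D (f ≫ g)))) =
      inv (WeakHomotopyClass.of (kernel.ι (proj D f))) ≫ WeakHomotopyClass.of k := by
    rw [IsIso.comp_inv_eq, Category.assoc, IsIso.eq_inv_comp, ← Functor.map_comp,
      ← Functor.map_comp, h₂]
  rw [cls, cls, toTotal_comp, WeakHomotopyClass.of_comp, Category.assoc, reassoc_of% h₄,
    ← WeakHomotopyClass.of_comp, h₃, WeakHomotopyClass.of_comp, Category.assoc, Category.assoc]

lemma exists_lift_of_toTotal_eq_zero [Cofibration i] (hB : IsWeaklyContractible B)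
    (h : IsCofibrant A ∨ IsLeftProper C) (hp : Fibration p.hom) (hY : IsFibrant p.right)
    (f : Arrow.mk i ⟶ p)
    (hf : WeakHomotopyClass.of (toTotal D f) = WeakHomotopyClass.of 0) :
    ∃ l : B ⟶ total D f, i ≫ l = toTotal D f ∧
      l ≫ proj D f = (D.factorizationData f.right).i := by
  have := isFibrant_base D hY f
  have hE := isWeaklyContractible_base D hB f
  have w := toTotal_proj D f
  obtain h | h := h
  · exact exists_lift_of_map_eq i (proj D f) hE _ _ w 0 (by simpa using hf)
  -- Replace `i` by the cofibration `b.i` with cofibrant source, weakly equivalent to it through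
  -- `a.p` and `b.p`.
  · let a := MorphismProperty.factorizationData (cofibrations C) (trivialFibrations C) (initial.to A)
    let b := MorphismProperty.factorizationData (cofibrations C) (trivialFibrations C) (a.p ≫ i)
    have : IsCofibrant a.Z := by
      rw [isCofibrant_iff, Subsingleton.elim (initial.to a.Z) a.i]
      infer_instance
    obtain ⟨l, hl, hl'⟩ := exists_lift_of_map_eq b.i (proj D f) hE (a.p ≫ toTotal D f)
      (b.p ≫ (D.factorizationData f.right).i) (by simp [w]) 0
      (by rw [WeakHomotopyClass.of_comp, hf, ← WeakHomotopyClass.of_comp, comp_zero, comp_zero])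
    exact exists_lift_of_isLeftProper i b.i a.p b.p b.fac _ _ _ w l hl hl'

lemma exists_lift_iff_cls_eq_zero [Cofibration i] (hB : IsWeaklyContractible B)
    (h : IsCofibrant A ∨ IsLeftProper C) (hp : Fibration p.hom) (hY : IsFibrant p.right)
    (f : Arrow.mk i ⟶ p) :
    (∃ l : B ⟶ p.left, i ≫ l = f.left ∧ l ≫ p.hom = f.right) ↔
      cls D hB hp hY f = WeakHomotopyClass.of 0 := by
  rw [cls_eq_zero_iff]
  constructor
  · rintro ⟨l, hl, hl'⟩
    let l' : B ⟶ total D f :=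
      pullback.lift l (D.factorizationData f.right).i (by simp [hl'])
    have e : toTotal D f = i ≫ l' := by
      apply pullback.hom_ext <;> simp [toTotal, l', hl]
    rw [e, WeakHomotopyClass.of_comp, hB.of_eq_zero l', ← WeakHomotopyClass.of_comp, comp_zero]
  · intro hf
    obtain ⟨l, hl, hl'⟩ := exists_lift_of_toTotal_eq_zero D hB h hp hY f hf
    refine ⟨l ≫ pullback.fst _ _, by simp [reassoc_of% hl, toTotal], ?_⟩
    rw [Category.assoc, pullback.condition, reassoc_of% hl']
    simp

end FibrantObstructionTheory

end HomotopicalAlgebra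

theorem corollary6p4 {C : Type u} [Category.{v} C] [ModelCategory C]
    [HasZeroObject C] [HasZeroMorphisms C]
    [MorphismProperty.HasFunctorialFactorization (trivialCofibrations C) (fibrations C)]
    [MorphismProperty.HasFunctorialFactorization (cofibrations C) (trivialFibrations C)]
    {A B : C} (i : A ⟶ B) (hi : Cofibration i) (hB : IsWeaklyContractible B)
    (h : IsCofibrant A ∨ IsLeftProper C) :
    HasFibrantObstructionTheory i := by
  exact ⟨{
    W := A
    obstruction _ hp hY f := FibrantObstructionTheory.cls
      (MorphismProperty.functorialFactorizationData _ _) hB hp hY f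
    exists_lift_iff _ hp hY f :=
      FibrantObstructionTheory.exists_lift_iff_cls_eq_zero _ hB h hp hY f
    obstruction_comp _ _ hp hY hp' hY' f g :=
      FibrantObstructionTheory.cls_comp _ hB hp hY hp' hY' f g }⟩
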